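/- **Theorem 1.3.** Let $n\ge 3$, let $g$ be the pseudo-Euclidean metric $g_{ij}=\delta_{ij}\varepsilon_i$, $\varepsilon_i\in\{1,-1\}$, on $\mathbb R^n$ with coordinates $x=(x_1,\dots,x_n)$, and let $\xi=\sum_{i=1}^n\alpha_i x_i$, where $\alpha_i\in\mathbb R$ and $\sum_{i=1}^n\varepsilon_i\alpha_i^2\neq 0$. (a) Let $I\subseteq\mathbb R$ be an open interval and let $\varphi,f:I\to\mathbb R$ be non-constant smooth functions, $\varphi$ nowhere zero and $f$ positive. On $\{x\in\mathbb R^n:\xi(x)\in I\}$ put $\overline g=\varphi(\xi)^{-2}g$. Then the warped product $$M=\big(\{\xi\in I\},\overline g\big)\times_{f(\xi)}\mathbb R,\qquad \widetilde g=\overline g+f(\xi)^2\,dt^2,$$ is Ricci-flat if and only if there are constants $k>0$, $k_1\neq 0$ and $k_2\in\mathbb R$ such that, for every $\xi\in I$, $(2-n)k_1\xi+k_2>0$ and $$|\varphi(\xi)|=\left[\frac{2}{(2-n)k_1\xi+k_2}\right]^{\frac{2}{n-2}},\qquad f(\xi)=\frac{2k}{(2-n)k_1\xi+k_2}.$$ (b)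 Conversely, for all $k>0$, $k_1\ne0$ and $k_2\in\mathbb R$, the functions $\varphi(\xi)=\left[\frac{2}{(2-n)k_1\xi+k_2}\right]^{2/(n-2)}$ and $f(\xi)=\frac{2k}{(2-n)k_1\xi+k_2}$ are smooth, positive and non-constant on the whole half space $(n-2)k_1\xi<k_2$ (that is, $\xi<\frac{k_2}{(n-2)k_1}$ if $k_1>0$, and $\xi>\frac{k_2}{(n-2)k_1}$ if $k_1<0$), and the warped product over this half space is Ricci-flat. -/

import Mathlib

open Set
open scoped ContDiff

noncomputable section

namespace WarpedRicci

section Curvature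

variable {ι : Type} [Fintype ι] [DecidableEq ι]

/-- The partial derivative of `F` with respect to the `i`-th coordinate. -/
def partialDeriv (i : ι) (F : (ι → ℝ) → ℝ) (x : ι → ℝ) : ℝ :=
  fderiv ℝ F x (Pi.single i 1)

/-- `G` (the matrix of components `G x i j = g(∂ᵢ, ∂ⱼ)`) is a semi-Riemannian metric on the
set `U` of a coordinate space: smooth, symmetric and nondegenerate at each point of `U`. -/
structure IsMetricOn (G : (ι → ℝ) → Matrix ι ι ℝ) (U : Set (ι → ℝ)) : Prop where
  smooth : ∀ i j, ContDiffOn ℝ ∞ (fun x => G x i j) U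
  symm : ∀ x ∈ U, (G x).IsSymm
  nondegenerate : ∀ x ∈ U, (G x).det ≠ 0

/-- The Christoffel symbol `Γᵏᵢⱼ` of the Levi-Civita connection of `G`. -/
def christoffel (G : (ι → ℝ) → Matrix ι ι ℝ) (k i j : ι) (x : ι → ℝ) : ℝ :=
  (1 / 2) * ∑ l, (G x)⁻¹ k l *
    (partialDeriv i (fun y => G y j l) x + partialDeriv j (fun y => G y i l) x
      - partialDeriv l (fun y => G y i j) x)

/-- The component `Rˡₖᵢⱼ` of the curvature tensor, i.e. the `∂ₗ`-component of
`∇_{∂ᵢ} ∇_{∂ⱼ} ∂ₖ - ∇_{∂ⱼ} ∇_{∂ᵢ} ∂ₖ`. -/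
def riemann (G : (ι → ℝ) → Matrix ι ι ℝ) (l k i j : ι) (x : ι → ℝ) : ℝ :=
  partialDeriv i (christoffel G l j k) x - partialDeriv j (christoffel G l i k) x
    + ∑ s, (christoffel G l i s x * christoffel G s j k x
        - christoffel G l j s x * christoffel G s i k x)

/-- The component `Ric(∂ₖ, ∂ⱼ) = ∑ᵢ Rⁱₖᵢⱼ` of the Ricci tensor. -/
def ricci (G : (ι → ℝ) → Matrix ι ι ℝ) (k j : ι) (x : ι → ℝ) : ℝ :=
  ∑ i, riemann G i k i j x

/-- `(U, G)` is a Ricci-flat semi-Riemannian manifold (for an open set `U`). -/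
def IsRicciFlat (G : (ι → ℝ) → Matrix ι ι ℝ) (U : Set (ι → ℝ)) : Prop :=
  IsMetricOn G U ∧ ∀ x ∈ U, ∀ k j, ricci G k j x = 0

end Curvature

section Warped

variable {ι κ : Type} [Fintype ι] [DecidableEq ι] [Fintype κ] [DecidableEq κ]

/-- The metric `(1 / φ²) g` conformal to the pseudo-Euclidean metric `gᵢⱼ = δᵢⱼ εᵢ`. -/
def conformalMetric (ε : ι → ℝ) (φ : (ι → ℝ) → ℝ) (x : ι → ℝ) : Matrix ι ι ℝ :=
  (1 / φ x ^ 2) • Matrix.diagonal ε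

/-- The Euclidean metric; on `Fin 1 → ℝ` it is the metric `dt²` of the line. -/
def euclideanMetric (_ : κ → ℝ) : Matrix κ κ ℝ := 1

/-- The warped product metric `g_B + f² g_F`, in the coordinates `ι ⊕ κ → ℝ` of the product
of the coordinate space of the base and that of the fiber. -/
def warpedMetric (gB : (ι → ℝ) → Matrix ι ι ℝ) (f : (ι → ℝ) → ℝ)
    (gF : (κ → ℝ) → Matrix κ κ ℝ) (p : ι ⊕ κ → ℝ) : Matrix (ι ⊕ κ) (ι ⊕ κ) ℝ :=
  Matrix.fromBlocks (gB (p ∘ Sum.inl)) 0 0 (f (p ∘ Sum.inl) ^ 2 • gF (p ∘ Sum.inr))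

/-- The product `U × V` in the coordinates `ι ⊕ κ → ℝ`. -/
def prodDomain (U : Set (ι → ℝ)) (V : Set (κ → ℝ)) : Set (ι ⊕ κ → ℝ) :=
  {p | p ∘ Sum.inl ∈ U ∧ p ∘ Sum.inr ∈ V}

/-- The basic invariant `ξ = ∑ αᵢ xᵢ`. -/
def xi (α : ι → ℝ) (x : ι → ℝ) : ℝ := ∑ i, α i * x i

/-- The part of the base on which a function of `ξ`, given for `ξ ∈ I`, is defined. -/
def strip (α : ι → ℝ) (I : Set ℝ) : Set (ι → ℝ) := {x | xi α x ∈ I}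

/-- The warped product `({ξ ∈ I}, φ(ξ)⁻² g) ×_{f(ξ)} ℝ` is a Ricci-flat manifold. -/
def WarpedProductIsRicciFlat (ε α : ι → ℝ) (I : Set ℝ) (φ f : ℝ → ℝ) : Prop :=
  IsRicciFlat
    (warpedMetric (conformalMetric ε fun x => φ (xi α x)) (fun x => f (xi α x))
      (euclideanMetric : (Fin 1 → ℝ) → Matrix (Fin 1) (Fin 1) ℝ))
    (prodDomain (strip α I) univ)

end Warped

/-- `h` is not constant on `I`. -/
def NonconstantOn (h : ℝ → ℝ) (I : Set ℝ) : Prop := ∃ s ∈ I, ∃ t ∈ I, h s ≠ h t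

/-- `[2 / ((2 - n) k₁ t + k₂)] ^ (2 / (n - 2))`. -/
def phiSol (n : ℕ) (k₁ k₂ t : ℝ) : ℝ :=
  (2 / ((2 - (n : ℝ)) * k₁ * t + k₂)) ^ (2 / ((n : ℝ) - 2))

/-- `2 k / ((2 - n) k₁ t + k₂)`. -/
def fSol (n : ℕ) (k k₁ k₂ t : ℝ) : ℝ :=
  2 * k / ((2 - (n : ℝ)) * k₁ * t + k₂)

/-- The values of `ξ` on the half space `(n - 2) k₁ ξ < k₂`; for `k₁ > 0` these are the
`ξ < k₂ / ((n - 2) k₁)`. -/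
def halfLine (n : ℕ) (k₁ k₂ : ℝ) : Set ℝ := {t | ((n : ℝ) - 2) * k₁ * t < k₂}

end WarpedRicci

end

/-! The metric is diagonal with entries depending only on `ξ`, so its Ricci tensor is `ββᵀ` times
one function of `ξ`, plus a diagonal part carrying the factor `∑ εᵢ αᵢ² ≠ 0` (`ricci_sum_eq`,
`ricci_stripMetric`). Its vanishing amounts to three ODEs in `u = φ'/φ` and `v = f'/f`
(`warpedProductIsRicciFlat_iff`).

Solving them (`exists_sol_of_ricciFlatEqs`): the base equation says that `φ' f / φ^(n-1)` is
constant. As `φ` is not constant, `φ'` never vanishes. Eliminating second derivatives leaves `(n-1)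
u ((n-2) u - 2 v) = 0`, hence `(n-2) u = 2 v`. The fiber equation becomes `f'' = 2 f'² / f`, so
`1/f` is affine, while `f² / φ^(n-2)` is constant; this gives both formulas. The converse is a
substitution (`ricciFlatEqs_sol`), and the sign of `φ` is immaterial because only `φ'/φ` and `φ''/φ`
enter. -/

open Filter Topology

namespace WarpedRicci

/-! ### Ricci tensor of a diagonal metric depending on one linear form -/

section RicciComputation

variable {ι : Type} [Fintype ι]

lemma hasFDerivAt_xi (β : ι → ℝ) (p : ι → ℝ) :
    HasFDerivAt (xi β) (∑ i, β i • ContinuousLinearMap.proj (R := ℝ) (φ := fun _ : ι => ℝ) i) p := by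
  unfold xi
  exact HasFDerivAt.fun_sum fun i _ => (hasFDerivAt_apply i p).const_mul (β i)

lemma continuous_xi (β : ι → ℝ) : Continuous (xi β) := by
  unfold xi; fun_prop

lemma contDiff_xi (β : ι → ℝ) : ContDiff ℝ ∞ (xi β) := by
  unfold xi; fun_prop

variable [DecidableEq ι]

lemma partialDeriv_comp_xi {F : ℝ → ℝ} {F' : ℝ} {β p : ι → ℝ}
    (h : HasDerivAt F F' (xi β p)) (i : ι) :
    partialDeriv i (fun y => F (xi β y)) p = β i * F' := by
  have := (h.comp_hasFDerivAt p (hasFDerivAt_xi β p)).fderiv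
  unfold partialDeriv
  change fderiv ℝ (F ∘ xi β) p _ = _
  rw [this]
  simp [Pi.single_apply, mul_comm]

omit [Fintype ι] in
lemma partialDeriv_congr {F F₁ : (ι → ℝ) → ℝ} {p : ι → ℝ} (h : F =ᶠ[𝓝 p] F₁) (i : ι) :
    partialDeriv i F p = partialDeriv i F₁ p := by
  unfold partialDeriv; rw [h.fderiv_eq]

/-- The Ricci tensor when the Christoffel symbols are functions of `ξ`. -/
lemma ricci_of_christoffel_comp_xi {G : (ι → ℝ) → Matrix ι ι ℝ} {β p : ι → ℝ}
    {C : ι → ι → ι → ℝ → ℝ} {C' : ι → ι → ι → ℝ}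
    (h : ∀ᶠ y in 𝓝 p, ∀ k i j, christoffel G k i j y = C k i j (xi β y))
    (hC : ∀ k i j, HasDerivAt (C k i j) (C' k i j) (xi β p)) (k j : ι) :
    ricci G k j p = ∑ i, (β i * C' i j k - β j * C' i i k
      + ∑ s, (C i i s (xi β p) * C s j k (xi β p) - C i j s (xi β p) * C s i k (xi β p))) := by
  have hd : ∀ a k i j, partialDeriv a (christoffel G k i j) p = β a * C' k i j := by
    intro a k i j
    rw [← partialDeriv_comp_xi (hC k i j) a]
    exact partialDeriv_congr (h.mono fun y hy => hy k i j) a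
  unfold ricci riemann
  simp only [hd, h.self_of_nhds]

/-- The Christoffel symbols of the diagonal metric with entries `ηₐ Hₐ(ξ)`, where
`wₐ = Hₐ' / (2 Hₐ)` and `mₐ = Hₐ' / (2 H_b)` for each `b` with `β_b ≠ 0`. -/
lemma christoffel_diagonal_comp_xi {β η p : ι → ℝ} {H : ι → ℝ → ℝ} {H' w m : ι → ℝ}
    {G : (ι → ℝ) → Matrix ι ι ℝ} (hG : ∀ y, G y = Matrix.diagonal fun a => η a * H a (xi β y))
    (hη : ∀ a, η a * η a = 1) (hH : ∀ a, H a (xi β p) ≠ 0)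
    (hd : ∀ a, HasDerivAt (H a) (H' a) (xi β p))
    (hw : ∀ a, H' a = 2 * H a (xi β p) * w a)
    (hm : ∀ a b, β b * H' a = β b * (2 * H b (xi β p) * m a)) (k i j : ι) :
    christoffel G k i j p = (if j = k then β i * w k else 0) + (if i = k then β j * w k else 0)
      - (if i = j then η i * (η k * β k) * m i else 0) := by
  have hη0 : ∀ a, η a ≠ 0 := fun a h => by simpa [h] using hη a
  have hinv : (G p)⁻¹ = Matrix.diagonal fun a => η a * (H a (xi β p))⁻¹ := by
    apply Matrix.inv_eq_left_inv
    rw [hG, Matrix.diagonal_mul_diagonal, ← Matrix.diagonal_one]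
    congr 1
    funext a
    have := hη a
    have h2 := hH a
    field_simp
    linarith
  have hpd : ∀ a b c, partialDeriv a (fun y => G y b c) p
      = if b = c then β a * (η b * H' b) else 0 := by
    intro a b c
    simp only [hG, Matrix.diagonal_apply]
    split_ifs with hbc
    · exact partialDeriv_comp_xi ((hd b).const_mul (η b)) a
    · simp [partialDeriv]
  unfold christoffel
  simp only [hinv, hpd, Matrix.diagonal_apply, ite_mul, zero_mul, Finset.sum_ite_eq,
    Finset.mem_univ, if_true]
  have hk := hH k
  have e1 : 1 / 2 * (η k * (H k (xi β p))⁻¹ * (η k * H' k)) = w k := by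
    rw [hw k]
    have := hη k
    field_simp
    linear_combination (w k) * this
  have e2 : 1 / 2 * (η k * (H k (xi β p))⁻¹ * (β k * (η i * H' i))) = η i * (η k * β k) * m i := by
    have := hm i k
    field_simp
    linear_combination η k * η i * this
  have s1 : ∀ a b, (if a = k then β b * (η a * H' a) else 0)
      = if a = k then β b * (η k * H' k) else 0 := by
    intro a b
    split_ifs with h
    · rw [h]
    · rfl
  rw [s1 j i, s1 i j, ← e1, ← e2]
  split_ifs <;> ring

variable {β η w w' m m' : ι → ℝ} {b b' : ℝ}

/-- The contraction of the curvature of Christoffel symbols of the form found in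
`christoffel_diagonal_comp_xi`. -/
lemma ricci_sum_eq (hη : ∀ a, η a * η a = 1)
    (hw : ∀ a, β a * w a = β a * b) (hm : ∀ a, β a * m a = β a * b)
    (hw' : ∀ a, β a * w' a = β a * b') (hm' : ∀ a, β a * m' a = β a * b')
    {C C' : ι → ι → ι → ℝ}
    (hC : ∀ k i j, C k i j = (if j = k then β i * w k else 0) + (if i = k then β j * w k else 0)
      - (if i = j then η i * (η k * β k) * m i else 0))
    (hC' : ∀ k i j, C' k i j = (if j = k then β i * w' k else 0)
      + (if i = k then β j * w' k else 0) - (if i = j then η i * (η k * β k) * m' i else 0))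
    (k j : ι) :
    ∑ i, (β i * C' i j k - β j * C' i i k + ∑ s, (C i i s * C s j k - C i j s * C s i k))
      = β j * β k * (2 * b' - ∑ a, w' a + 2 * (∑ a, w a) * b - ∑ a, w a ^ 2 - 2 * b ^ 2)
        + (if j = k then η j * (∑ a, η a * β a ^ 2)
            * (-m' j - (∑ a, w a) * m j + 2 * w j * m j) else 0) := by
  -- The extra terms `β s * w s` and `β s * m s` cancel, both being `β s * b`.
  have tr : ∀ s, ∑ i, C i i s = β s * ∑ a, w a := by
    intro s
    simp only [hC, Finset.sum_add_distrib, Finset.sum_sub_distrib, Finset.sum_ite_eq,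
      Finset.sum_ite_eq', Finset.mem_univ, if_true, Finset.mul_sum]
    linear_combination hw s - hm s - β s * m s * hη s
  have tr' : ∑ i, C' i i k = β k * ∑ a, w' a := by
    simp only [hC', Finset.sum_add_distrib, Finset.sum_sub_distrib, Finset.sum_ite_eq,
      Finset.sum_ite_eq', Finset.mem_univ, if_true, Finset.mul_sum]
    linear_combination hw' k - hm' k - β k * m' k * hη k
  have dv : ∑ s, β s * C s j k = 2 * β j * β k * b
      - if j = k then η j * (∑ a, η a * β a ^ 2) * m j else 0 := by
    have e : ∑ a, β a * (η j * (η a * β a) * m j) = η j * (∑ a, η a * β a ^ 2) * m j := by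
      rw [Finset.mul_sum, Finset.sum_mul]
      exact Finset.sum_congr rfl fun a _ => by ring
    simp only [hC, mul_add, mul_sub, mul_ite, mul_zero, Finset.sum_add_distrib,
      Finset.sum_sub_distrib, Finset.sum_ite_eq, Finset.mem_univ, if_true, Finset.sum_ite_irrel,
      Finset.sum_const_zero, e]
    linear_combination β j * hw k + β k * hw j
  have dv' : ∑ s, β s * C' s j k = 2 * β j * β k * b'
      - if j = k then η j * (∑ a, η a * β a ^ 2) * m' j else 0 := by
    have e : ∑ a, β a * (η j * (η a * β a) * m' j) = η j * (∑ a, η a * β a ^ 2) * m' j := by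
      rw [Finset.mul_sum, Finset.sum_mul]
      exact Finset.sum_congr rfl fun a _ => by ring
    simp only [hC', mul_add, mul_sub, mul_ite, mul_zero, Finset.sum_add_distrib,
      Finset.sum_sub_distrib, Finset.sum_ite_eq, Finset.mem_univ, if_true, Finset.sum_ite_irrel,
      Finset.sum_const_zero, e]
    linear_combination β j * hw' k + β k * hw' j
  have q : ∑ i, ∑ s, C i j s * C s i k = β j * β k * (∑ a, w a ^ 2 + 2 * b ^ 2)
      - if j = k then η j * (∑ a, η a * β a ^ 2) * (2 * w j * m j) else 0 := by
    have q1 : ∑ i, w i * C i i k = β k * w k ^ 2 + β k * ∑ a, w a ^ 2 - β k * w k * m k := by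
      have e : ∑ a, w a * (β k * w a) = β k * ∑ a, w a ^ 2 := by
        rw [Finset.mul_sum]
        exact Finset.sum_congr rfl fun a _ => by ring
      simp only [hC, mul_add, mul_sub, mul_ite, mul_zero, Finset.sum_add_distrib, if_true,
        Finset.sum_sub_distrib, Finset.sum_ite_eq, Finset.sum_ite_eq', Finset.mem_univ, e]
      linear_combination -w k * β k * m k * hη k
    have q2 : ∑ i, η i * β i * C j i k = (if j = k then (∑ a, η a * β a ^ 2) * w j else 0)
        + η j * β j * β k * w j - η j * β j * β k * m k := by
      have e : ∑ a, η a * β a * (β a * w j) = (∑ a, η a * β a ^ 2) * w j := by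
        rw [Finset.sum_mul]
        exact Finset.sum_congr rfl fun a _ => by ring
      simp only [hC, mul_add, mul_sub, mul_ite, mul_zero, Finset.sum_add_distrib, if_true,
        Finset.sum_sub_distrib, Finset.sum_ite_eq', Finset.mem_univ,
        Finset.sum_ite_irrel, Finset.sum_const_zero, e, eq_comm (a := k) (b := j)]
      linear_combination -η j * β j * β k * m k * hη k
    -- Only the first factor is expanded: its three terms leave the contractions `q1`, `dv` and
    -- `q2`.
    have q3 : ∀ i, ∑ s, C i j s * C s i k = β j * (w i * C i i k)
        + (if j = i then w i * ∑ s, β s * C s i k else 0)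
        - η j * m j * (η i * β i * C j i k) := by
      intro i
      have e : ∑ s, β s * w i * C s i k = w i * ∑ s, β s * C s i k := by
        rw [Finset.mul_sum]
        exact Finset.sum_congr rfl fun a _ => by ring
      simp only [hC i j, add_mul, sub_mul, ite_mul, zero_mul, Finset.sum_add_distrib, if_true,
        Finset.sum_sub_distrib, Finset.sum_ite_eq, Finset.sum_ite_eq', Finset.mem_univ,
        Finset.sum_ite_irrel, Finset.sum_const_zero, e]
      ring
    simp only [q3, Finset.sum_add_distrib, Finset.sum_sub_distrib, ← Finset.mul_sum, q1, q2,
      Finset.sum_ite_eq, Finset.mem_univ, if_true, dv]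
    have hj := hη j
    have cross : β j * β k * (w k ^ 2 - w k * m k) = 0 := by
      linear_combination β j * w k * (hw k - hm k)
    split_ifs <;>
      linear_combination cross + 2 * β k * b * hw j - β k * m j * β j * (w j - m k) * hj
        - β k * m j * hw j + β j * m j * hm k
  have t : ∑ i, ∑ s, C i i s * C s j k = (∑ a, w a) * ∑ s, β s * C s j k := by
    rw [Finset.sum_comm, Finset.mul_sum]
    refine Finset.sum_congr rfl fun s _ => ?_
    rw [← Finset.sum_mul, tr]; ring
  simp only [Finset.sum_add_distrib, Finset.sum_sub_distrib, ← Finset.mul_sum, tr', dv', q, t, dv]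
  split_ifs <;> ring

end RicciComputation

/-! ### Ricci tensor of the warped product -/

section WarpedStrip

variable {n : ℕ}

lemma hasDerivAt_of_contDiffOn {φ : ℝ → ℝ} {I : Set ℝ} (hI : IsOpen I) (hφ : ContDiffOn ℝ ∞ φ I)
    {t : ℝ} (ht : t ∈ I) :
    HasDerivAt φ (deriv φ t) t ∧ HasDerivAt (deriv φ) (deriv (deriv φ) t) t := by
  have h2 : ContDiffOn ℝ ∞ (deriv φ) I := hφ.deriv_of_isOpen hI (by simp)
  exact ⟨((hφ.differentiableOn (by simp)).differentiableAt (hI.mem_nhds ht)).hasDerivAt,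
    ((h2.differentiableOn (by simp)).differentiableAt (hI.mem_nhds ht)).hasDerivAt⟩

/-- Extending `α` by zero along the fiber turns `ξ` into a linear form on the whole product, as the
diagonal computation requires. -/
lemma xi_comp_inl (α : Fin n → ℝ) (p : Fin n ⊕ Fin 1 → ℝ) :
    xi α (p ∘ Sum.inl) = xi (Sum.elim α 0) p := by
  simp [xi]

lemma mem_prodDomain_strip {α : Fin n → ℝ} {I : Set ℝ} {p : Fin n ⊕ Fin 1 → ℝ} :
    p ∈ prodDomain (strip α I) univ ↔ xi (Sum.elim α 0) p ∈ I := by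
  simp [prodDomain, strip, xi_comp_inl]

/-- The metric of the warped product `({ξ ∈ I}, φ(ξ)⁻² g) ×_{f(ξ)} ℝ`. -/
noncomputable abbrev stripMetric (ε α : Fin n → ℝ) (φ f : ℝ → ℝ) :
    (Fin n ⊕ Fin 1 → ℝ) → Matrix (Fin n ⊕ Fin 1) (Fin n ⊕ Fin 1) ℝ :=
  warpedMetric (conformalMetric ε fun x => φ (xi α x)) (fun x => f (xi α x)) euclideanMetric

lemma stripMetric_eq_diagonal (ε α : Fin n → ℝ) (φ f : ℝ → ℝ) (p : Fin n ⊕ Fin 1 → ℝ) :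
    stripMetric ε α φ f p = Matrix.diagonal fun a => (Sum.elim ε 1 : Fin n ⊕ Fin 1 → ℝ) a *
      (Sum.elim (fun _ t => 1 / φ t ^ 2) (fun _ t => f t ^ 2) : Fin n ⊕ Fin 1 → ℝ → ℝ) a
        (xi (Sum.elim α 0) p) := by
  ext (i | i) (j | j)
  · simp [warpedMetric, conformalMetric, xi_comp_inl, Matrix.diagonal_apply, mul_comm]
  · simp [warpedMetric]
  · simp [warpedMetric]
  · simp [warpedMetric, euclideanMetric, xi_comp_inl, Matrix.one_apply, Matrix.diagonal_apply]

/-- The Ricci tensor of the warped product `({ξ ∈ I}, φ(ξ)⁻² g) ×_{f(ξ)} ℝ`. -/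
lemma ricci_stripMetric {ε α : Fin n → ℝ} (hε : ∀ i, ε i = 1 ∨ ε i = -1) {I : Set ℝ}
    (hI : IsOpen I) {φ f : ℝ → ℝ} (hφ : ContDiffOn ℝ ∞ φ I) (hf : ContDiffOn ℝ ∞ f I)
    (hφ0 : ∀ t ∈ I, φ t ≠ 0) (hf0 : ∀ t ∈ I, f t ≠ 0) {p : Fin n ⊕ Fin 1 → ℝ} {t : ℝ}
    (hpt : xi (Sum.elim α 0) p = t) (ht : t ∈ I) (k j : Fin n ⊕ Fin 1) :
    ricci (stripMetric ε α φ f) k j p =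
      (Sum.elim α 0 : Fin n ⊕ Fin 1 → ℝ) j * (Sum.elim α 0 : Fin n ⊕ Fin 1 → ℝ) k *
        ((n - 2) * (deriv (deriv φ) t / φ t) - deriv (deriv f) t / f t
          - 2 * (deriv φ t / φ t) * (deriv f t / f t))
      + (if j = k then (Sum.elim ε 1 : Fin n ⊕ Fin 1 → ℝ) j * (∑ i, ε i * α i ^ 2) *
          (Sum.elim (fun _ => deriv (deriv φ) t / φ t - (n - 1) * (deriv φ t / φ t) ^ 2
              + (deriv φ t / φ t) * (deriv f t / f t))
            (fun _ => -(f t * φ t ^ 2 * (deriv (deriv f) t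
              - (n - 2) * (deriv φ t / φ t) * deriv f t))) : Fin n ⊕ Fin 1 → ℝ) j else 0) := by
  set β : Fin n ⊕ Fin 1 → ℝ := Sum.elim α 0 with hβ
  set η : Fin n ⊕ Fin 1 → ℝ := Sum.elim ε 1 with hηdef
  have hη : ∀ a, η a * η a = 1 := by
    rintro (a | a)
    · rcases hε a with h | h <;> simp [hηdef, h]
    · simp [hηdef]
  let w : Fin n ⊕ Fin 1 → ℝ → ℝ :=
    Sum.elim (fun _ s => -(deriv φ s / φ s)) (fun _ s => deriv f s / f s)
  let m : Fin n ⊕ Fin 1 → ℝ → ℝ :=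
    Sum.elim (fun _ s => -(deriv φ s / φ s)) (fun _ s => f s * deriv f s * φ s ^ 2)
  let w' : Fin n ⊕ Fin 1 → ℝ :=
    Sum.elim (fun _ => -(deriv (deriv φ) t / φ t - (deriv φ t / φ t) ^ 2))
      (fun _ => deriv (deriv f) t / f t - (deriv f t / f t) ^ 2)
  let m' : Fin n ⊕ Fin 1 → ℝ :=
    Sum.elim (fun _ => -(deriv (deriv φ) t / φ t - (deriv φ t / φ t) ^ 2))
      (fun _ => (deriv f t * deriv f t + f t * deriv (deriv f) t) * φ t ^ 2
        + f t * deriv f t * (2 * φ t * deriv φ t))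
  obtain ⟨dφ, ddφ⟩ := hasDerivAt_of_contDiffOn hI hφ ht
  obtain ⟨df, ddf⟩ := hasDerivAt_of_contDiffOn hI hf ht
  have h0 := hφ0 t ht
  have h1 := hf0 t ht
  have hdw : ∀ a, HasDerivAt (w a) (w' a) t := by
    rintro (a | a)
    · exact (ddφ.div dφ h0).neg.congr_deriv (by simp [w']; field_simp; ring)
    · exact (ddf.div df h1).congr_deriv (by simp [w']; field_simp)
  have hdm : ∀ a, HasDerivAt (m a) (m' a) t := by
    rintro (a | a)
    · exact (ddφ.div dφ h0).neg.congr_deriv (by simp [m']; field_simp; ring)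
    · exact ((df.mul ddf).mul (dφ.pow 2)).congr_deriv (by simp [m'])
  let C : Fin n ⊕ Fin 1 → Fin n ⊕ Fin 1 → Fin n ⊕ Fin 1 → ℝ → ℝ := fun k i j s =>
    (if j = k then β i * w k s else 0) + (if i = k then β j * w k s else 0)
      - (if i = j then η i * (η k * β k) * m i s else 0)
  let C' : Fin n ⊕ Fin 1 → Fin n ⊕ Fin 1 → Fin n ⊕ Fin 1 → ℝ := fun k i j =>
    (if j = k then β i * w' k else 0) + (if i = k then β j * w' k else 0)
      - (if i = j then η i * (η k * β k) * m' i else 0)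
  have hdC : ∀ k i j, HasDerivAt (C k i j) (C' k i j) t := by
    have ite : ∀ (P : Prop) [Decidable P] (F : ℝ → ℝ) (F' : ℝ), HasDerivAt F F' t →
        HasDerivAt (fun s => if P then F s else 0) (if P then F' else 0) t := by
      intro P _ F F' h
      by_cases hP : P
      · simpa [hP] using h
      · simpa [hP] using hasDerivAt_const t (0 : ℝ)
    intro k i j
    exact ((ite _ _ _ ((hdw k).const_mul _)).add (ite _ _ _ ((hdw k).const_mul _))).sub
      (ite _ _ _ ((hdm i).const_mul _))
  have hev : ∀ᶠ y in 𝓝 p, xi β y ∈ I :=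
    (continuous_xi β).continuousAt.eventually (hI.mem_nhds (by rw [hpt]; exact ht))
  -- The formula is needed near `p`, not just at `p`, since curvature differentiates the Christoffel
  -- symbols.
  have hchr : ∀ᶠ y in 𝓝 p, ∀ k i j,
      christoffel (stripMetric ε α φ f) k i j y = C k i j (xi β y) := by
    filter_upwards [hev] with y hy k i j
    have e0 := hφ0 _ hy
    have e1 := hf0 _ hy
    obtain ⟨dφ, -⟩ := hasDerivAt_of_contDiffOn hI hφ hy
    obtain ⟨df, -⟩ := hasDerivAt_of_contDiffOn hI hf hy
    refine christoffel_diagonal_comp_xi (β := β) (η := η)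
      (H' := Sum.elim (fun _ => -(2 * deriv φ (xi β y) / φ (xi β y) ^ 3))
        (fun _ => 2 * f (xi β y) * deriv f (xi β y)))
      (w := fun a => w a (xi β y)) (m := fun a => m a (xi β y))
      (stripMetric_eq_diagonal ε α φ f) hη ?_ ?_ ?_ ?_ k i j
    · rintro (a | a) <;> simp [e0, e1]
    · rintro (a | a)
      · exact ((hasDerivAt_const _ (1 : ℝ)).div (dφ.pow 2) (pow_ne_zero 2 e0)).congr_deriv
          (by simp; field_simp)
      · exact (df.pow 2).congr_deriv (by simp)
    · rintro (a | a)
      · simp [w]; field_simp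
      · simp [w]; field_simp
    -- All base entries share the factor `1 / φ²`, so `m` does not depend on the base index `b`; for
    -- fiber `b` both sides vanish with `β b`.
    · rintro (a | a) (b | b)
      · exact congrArg (β _ * ·) (by simp [m]; field_simp)
      · simp [hβ]
      · exact congrArg (β _ * ·) (by simp [m]; field_simp)
      · simp [hβ]
  rw [ricci_of_christoffel_comp_xi hchr (fun k i j => by rw [hpt]; exact hdC k i j), hpt,
    ricci_sum_eq (β := β) (η := η) (w := fun a => w a t) (m := fun a => m a t) (w' := w') (m' := m')
      (b := -(deriv φ t / φ t)) (b' := -(deriv (deriv φ) t / φ t - (deriv φ t / φ t) ^ 2))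
      (C := fun k i j => C k i j t) (C' := C') hη ?_ ?_ ?_ ?_ (fun _ _ _ => rfl) (fun _ _ _ => rfl)]
  · have sN : ∑ a, η a * β a ^ 2 = ∑ i, ε i * α i ^ 2 := by simp [hηdef, hβ]
    have sw : ∑ a, w a t = -(n * (deriv φ t / φ t)) + deriv f t / f t := by simp [w]
    have sw2 : ∑ a, w a t ^ 2 = n * (deriv φ t / φ t) ^ 2 + (deriv f t / f t) ^ 2 := by simp [w]
    have sw' : ∑ a, w' a = -(n * (deriv (deriv φ) t / φ t - (deriv φ t / φ t) ^ 2))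
        + (deriv (deriv f) t / f t - (deriv f t / f t) ^ 2) := by simp [w']; ring
    rw [sN, sw, sw2, sw']
    congr 1
    · ring
    · split_ifs with hjk
      · congr 1
        rcases j with j | j
        · simp [w, m, m']; ring
        · simp [w, m, m']; field_simp; ring
      · rfl
  all_goals rintro (a | a) <;> simp [hβ, w, m, w', m']

end WarpedStrip

/-! ### Reduction of Ricci-flatness to ODEs -/

section RicciFlatEquations

variable {n : ℕ}

/-- The witness is the multiple of the `g`-gradient `(εᵢ αᵢ)` on which `ξ` equals `t`; every `t ∈ I`
is thus attained, and the ODEs hold on all of `I`. -/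
lemma exists_xi_eq {ε α : Fin n → ℝ} (hα : ∑ i, ε i * α i ^ 2 ≠ 0) (t : ℝ) :
    ∃ p : Fin n ⊕ Fin 1 → ℝ, xi (Sum.elim α 0) p = t := by
  refine ⟨Sum.elim (fun i => t / (∑ i, ε i * α i ^ 2) * (ε i * α i)) 0, ?_⟩
  have e : ∀ i, α i * (t / (∑ i, ε i * α i ^ 2) * (ε i * α i))
      = t / (∑ i, ε i * α i ^ 2) * (ε i * α i ^ 2) := fun i => by ring
  simp only [xi, Fintype.sum_sum_type, Sum.elim_inl, Sum.elim_inr, e, ← Finset.mul_sum]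
  simp [div_mul_cancel₀ t hα]

lemma isMetricOn_stripMetric {ε α : Fin n → ℝ} (hε : ∀ i, ε i = 1 ∨ ε i = -1) {I : Set ℝ}
    {φ f : ℝ → ℝ} (hφ : ContDiffOn ℝ ∞ φ I) (hf : ContDiffOn ℝ ∞ f I)
    (hφ0 : ∀ t ∈ I, φ t ≠ 0) (hf0 : ∀ t ∈ I, f t ≠ 0) :
    IsMetricOn (stripMetric ε α φ f) (prodDomain (strip α I) univ) := by
  have hmaps : MapsTo (xi (Sum.elim α 0)) (prodDomain (strip α I) univ) I :=
    fun p hp => mem_prodDomain_strip.1 hp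
  have hxi : ContDiffOn ℝ ∞ (xi (Sum.elim α 0 : Fin n ⊕ Fin 1 → ℝ))
      (prodDomain (strip α I) univ) := (contDiff_xi _).contDiffOn
  refine ⟨fun i j => ?_, fun p _ => ?_, fun p hp => ?_⟩
  · simp only [stripMetric_eq_diagonal, Matrix.diagonal_apply]
    split_ifs
    · refine contDiffOn_const.mul ?_
      rcases i with i | i
      · exact (contDiffOn_const.div (hφ.pow 2) fun t ht => pow_ne_zero 2 (hφ0 t ht)).comp hxi hmaps
      · exact (hf.pow 2).comp hxi hmaps
    · exact contDiffOn_const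
  · rw [stripMetric_eq_diagonal]
    exact Matrix.isSymm_diagonal _
  · have h0 := hφ0 _ (hmaps hp)
    have h1 := hf0 _ (hmaps hp)
    rw [stripMetric_eq_diagonal, Matrix.det_diagonal, Finset.prod_ne_zero_iff]
    rintro (a | a) -
    · rcases hε a with h | h <;> simp [h, h0]
    · simp [h1]

/-- The equations on `φ` and `f` equivalent to Ricci-flatness of `({ξ ∈ I}, φ(ξ)⁻² g) ×_{f(ξ)} ℝ`,
at the point `t`. -/
structure RicciFlatEqs (n : ℕ) (φ f : ℝ → ℝ) (t : ℝ) : Prop where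
  mixed : (n - 2) * (deriv (deriv φ) t / φ t) - deriv (deriv f) t / f t
    - 2 * (deriv φ t / φ t) * (deriv f t / f t) = 0
  base : deriv (deriv φ) t / φ t - (n - 1) * (deriv φ t / φ t) ^ 2
    + (deriv φ t / φ t) * (deriv f t / f t) = 0
  fiber : deriv (deriv f) t - (n - 2) * (deriv φ t / φ t) * deriv f t = 0

lemma warpedProductIsRicciFlat_iff (hn : 2 ≤ n) {ε α : Fin n → ℝ}
    (hε : ∀ i, ε i = 1 ∨ ε i = -1) (hα : ∑ i, ε i * α i ^ 2 ≠ 0) {I : Set ℝ}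
    (hI : IsOpen I) {φ f : ℝ → ℝ} (hφ : ContDiffOn ℝ ∞ φ I) (hf : ContDiffOn ℝ ∞ f I)
    (hφ0 : ∀ t ∈ I, φ t ≠ 0) (hf0 : ∀ t ∈ I, f t ≠ 0) :
    WarpedProductIsRicciFlat ε α I φ f ↔ ∀ t ∈ I, RicciFlatEqs n φ f t := by
  constructor
  · rintro ⟨-, h⟩ t ht
    obtain ⟨p, hp⟩ := exists_xi_eq hα t
    have hric : ∀ k j, _ = (0 : ℝ) := fun k j =>
      (ricci_stripMetric hε hI hφ hf hφ0 hf0 hp ht k j).symm.trans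
        (h p (mem_prodDomain_strip.2 (hp ▸ ht)) k j)
    obtain ⟨i₀, h₀⟩ : ∃ i, α i ≠ 0 := by
      by_contra! hc
      exact hα (by simp [hc])
    have : Nontrivial (Fin n) := Fin.nontrivial_iff_two_le.2 hn
    obtain ⟨i₁, h₁⟩ := exists_ne i₀
    have hε0 : ∀ i, ε i ≠ 0 := fun i => by rcases hε i with h | h <;> simp [h]
    have e01 := hric (Sum.inl i₀) (Sum.inl i₁)
    have e00 := hric (Sum.inl i₀) (Sum.inl i₀)
    have e11 := hric (Sum.inl i₁) (Sum.inl i₁)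
    have ett := hric (Sum.inr 0) (Sum.inr 0)
    simp only [Sum.elim_inl, Sum.inl.injEq, if_neg h₁, add_zero, if_true] at e01 e00 e11
    simp only [Sum.elim_inr, Pi.zero_apply, zero_mul, zero_add, if_true, Pi.one_apply, one_mul,
      mul_eq_zero, hα, neg_eq_zero, hf0 t ht, pow_eq_zero_iff two_ne_zero, hφ0 t ht,
      false_or] at ett
    -- If `α i₁ = 0`, the diagonal entry at `i₁` isolates the base equation; otherwise the
    -- off-diagonal entry isolates the mixed one. The entry at `i₀` then gives the other.
    by_cases hz : α i₁ = 0
    · rw [hz, zero_mul, zero_mul, zero_add] at e11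
      have hB := (mul_eq_zero.1 e11).resolve_left (mul_ne_zero (hε0 i₁) hα)
      rw [hB, mul_zero, add_zero] at e00
      exact ⟨(mul_eq_zero.1 e00).resolve_left (mul_ne_zero h₀ h₀), hB, ett⟩
    · have hA := (mul_eq_zero.1 e01).resolve_left (mul_ne_zero hz h₀)
      rw [hA, mul_zero, zero_add] at e00
      exact ⟨hA, (mul_eq_zero.1 e00).resolve_left (mul_ne_zero (hε0 i₀) hα), ett⟩
  · intro h
    refine ⟨isMetricOn_stripMetric hε hφ hf hφ0 hf0, fun p hp k j => ?_⟩
    have ht := mem_prodDomain_strip.1 hp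
    have h := h _ ht
    refine (ricci_stripMetric hε hI hφ hf hφ0 hf0 rfl ht k j).trans ?_
    rw [h.mixed, h.base, h.fiber]
    rcases j with j | j <;> simp

end RicciFlatEquations

/-! ### Explicit solutions and integration of the ODEs -/

section Solutions

variable {n : ℕ}

/-- The equations see `φ` only through `φ'/φ` and `φ''/φ`, so a constant factor drops out; `c = ±1`
serves to remove `|φ|`. -/
lemma RicciFlatEqs.congr {φ φ₁ f f₁ : ℝ → ℝ} {t c : ℝ} (hc : c ≠ 0)
    (hφ : φ =ᶠ[𝓝 t] fun s => c * φ₁ s) (hf : f =ᶠ[𝓝 t] f₁) (h : RicciFlatEqs n φ₁ f₁ t) :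
    RicciFlatEqs n φ f t := by
  have e1 : deriv φ =ᶠ[𝓝 t] fun s => c * deriv φ₁ s := by
    filter_upwards [hφ.deriv] with s hs
    rw [hs, deriv_const_mul_field]
  have e2 : deriv (deriv φ) t = c * deriv (deriv φ₁) t := by
    rw [e1.deriv_eq, deriv_const_mul_field]
  have r1 : deriv φ t / φ t = deriv φ₁ t / φ₁ t := by
    rw [e1.self_of_nhds, hφ.self_of_nhds, mul_div_mul_left _ _ hc]
  have r2 : deriv (deriv φ) t / φ t = deriv (deriv φ₁) t / φ₁ t := by
    rw [e2, hφ.self_of_nhds, mul_div_mul_left _ _ hc]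
  refine ⟨?_, ?_, ?_⟩ <;> rw [r1] <;> try rw [r2]
  · rw [hf.deriv.deriv_eq, hf.deriv_eq, hf.self_of_nhds]; exact h.mixed
  · rw [hf.deriv_eq, hf.self_of_nhds]; exact h.base
  · rw [hf.deriv.deriv_eq, hf.deriv_eq]; exact h.fiber

/-- The denominator of `phiSol` and `fSol`. -/
abbrev denom (n : ℕ) (k₁ k₂ t : ℝ) : ℝ := (2 - (n : ℝ)) * k₁ * t + k₂

lemma mem_halfLine {k₁ k₂ t : ℝ} : t ∈ halfLine n k₁ k₂ ↔ 0 < denom n k₁ k₂ t := by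
  simp only [halfLine, mem_ofPred_eq, denom]
  constructor <;> intro h <;> linarith

lemma isOpen_halfLine (k₁ k₂ : ℝ) : IsOpen (halfLine n k₁ k₂) :=
  isOpen_lt (by fun_prop) continuous_const

lemma phiSol_pos {k₁ k₂ t : ℝ} (ht : t ∈ halfLine n k₁ k₂) : 0 < phiSol n k₁ k₂ t :=
  Real.rpow_pos_of_pos (div_pos two_pos (mem_halfLine.1 ht)) _

lemma fSol_pos {k k₁ k₂ t : ℝ} (hk : 0 < k) (ht : t ∈ halfLine n k₁ k₂) :
    0 < fSol n k k₁ k₂ t :=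
  div_pos (mul_pos two_pos hk) (mem_halfLine.1 ht)

lemma contDiffOn_fSol (k k₁ k₂ : ℝ) : ContDiffOn ℝ ∞ (fSol n k k₁ k₂) (halfLine n k₁ k₂) :=
  contDiffOn_const.div (by fun_prop) fun _ ht => (mem_halfLine.1 ht).ne'

lemma contDiffOn_phiSol (k₁ k₂ : ℝ) : ContDiffOn ℝ ∞ (phiSol n k₁ k₂) (halfLine n k₁ k₂) :=
  (contDiffOn_const.div (by fun_prop) fun _ ht => (mem_halfLine.1 ht).ne').rpow_const_of_ne
    fun _ ht => (div_pos two_pos (mem_halfLine.1 ht)).ne'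

lemma hasDerivAt_denom (k₁ k₂ t : ℝ) : HasDerivAt (denom n k₁ k₂) ((2 - n) * k₁) t := by
  simpa using ((hasDerivAt_id t).const_mul ((2 - (n : ℝ)) * k₁)).add_const k₂

lemma hasDerivAt_fSol {k k₁ k₂ t : ℝ} (ht : t ∈ halfLine n k₁ k₂) :
    HasDerivAt (fSol n k k₁ k₂) (fSol n k k₁ k₂ t * ((n - 2) * k₁ / denom n k₁ k₂ t)) t := by
  have h := (mem_halfLine.1 ht).ne'
  refine ((hasDerivAt_const t (2 * k)).div (hasDerivAt_denom k₁ k₂ t) h).congr_deriv ?_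
  simp only [fSol]
  rw [← denom]
  field_simp
  ring

lemma hasDerivAt_phiSol (hn : 3 ≤ n) {k₁ k₂ t : ℝ} (ht : t ∈ halfLine n k₁ k₂) :
    HasDerivAt (phiSol n k₁ k₂) (phiSol n k₁ k₂ t * (2 * k₁ / denom n k₁ k₂ t)) t := by
  have hpos := mem_halfLine.1 ht
  have h := hpos.ne'
  have hn2 : (n : ℝ) - 2 ≠ 0 := by
    have : (3 : ℝ) ≤ n := by exact_mod_cast hn
    linarith
  have h2 : 2 / denom n k₁ k₂ t ≠ 0 := div_ne_zero two_ne_zero h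
  refine (((hasDerivAt_const t (2 : ℝ)).div (hasDerivAt_denom k₁ k₂ t) h).rpow_const
    (p := 2 / ((n : ℝ) - 2)) (Or.inl h2)).congr_deriv ?_
  simp only [phiSol]
  rw [← denom, Pi.div_apply, Real.rpow_sub_one h2]
  field_simp
  ring

lemma deriv_deriv_of_logDeriv {g u : ℝ → ℝ} {u' t : ℝ} {I : Set ℝ} (hI : IsOpen I) (ht : t ∈ I)
    (hg : ∀ s ∈ I, HasDerivAt g (g s * u s) s) (hu : HasDerivAt u u' t) :
    deriv (deriv g) t = g t * (u t ^ 2 + u') := by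
  have e : deriv g =ᶠ[𝓝 t] fun s => g s * u s := by
    filter_upwards [hI.mem_nhds ht] with s hs using (hg s hs).deriv
  exact e.deriv_eq.trans (((hg t ht).mul hu).deriv.trans (by ring))

lemma ricciFlatEqs_sol (hn : 3 ≤ n) {k k₁ k₂ t : ℝ} (hk : 0 < k) (ht : t ∈ halfLine n k₁ k₂) :
    RicciFlatEqs n (phiSol n k₁ k₂) (fSol n k k₁ k₂) t := by
  have h := (mem_halfLine.1 ht).ne'
  have hP := (phiSol_pos ht).ne'
  have hF := (fSol_pos hk ht).ne'
  have d : ∀ c : ℝ, HasDerivAt (fun s => c / denom n k₁ k₂ s)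
      (c * ((n - 2) * k₁) / denom n k₁ k₂ t ^ 2) t := fun c =>
    ((hasDerivAt_const t c).div (hasDerivAt_denom k₁ k₂ t) h).congr_deriv (by ring)
  have p1 := (hasDerivAt_phiSol hn ht).deriv
  have f1 := (hasDerivAt_fSol (k := k) ht).deriv
  have p2 := deriv_deriv_of_logDeriv (isOpen_halfLine k₁ k₂) ht
    (fun s hs => hasDerivAt_phiSol hn hs) (d (2 * k₁))
  have f2 := deriv_deriv_of_logDeriv (isOpen_halfLine k₁ k₂) ht
    (fun s hs => hasDerivAt_fSol (k := k) hs) (d ((n - 2) * k₁))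
  -- With the logarithmic derivatives `2 k₁ / L` and `(n-2) k₁ / L` known, the real power plays no
  -- further role: rational identities in `L` remain.
  generalize phiSol n k₁ k₂ = P at *
  generalize fSol n k k₁ k₂ = F at *
  generalize denom n k₁ k₂ t = L at *
  constructor
  all_goals
    simp only [p1, p2, f1, f2, mul_div_cancel_left₀ _ hP, mul_div_cancel_left₀ _ hF]
    field_simp
    ring

lemma exists_denom_eq (hn : 3 ≤ n) {k₁ : ℝ} (hk₁ : k₁ ≠ 0) (k₂ s : ℝ) :
    ∃ t, denom n k₁ k₂ t = s := by
  have hn2 : (2 : ℝ) - n ≠ 0 := by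
    have : (3 : ℝ) ≤ n := by exact_mod_cast hn
    linarith
  exact ⟨(s - k₂) / ((2 - n) * k₁), by
    rw [denom, mul_div_cancel₀ _ (mul_ne_zero hn2 hk₁), sub_add_cancel]⟩

lemma nonconstantOn_sol (hn : 3 ≤ n) {k k₁ k₂ : ℝ} (hk : 0 < k) (hk₁ : k₁ ≠ 0) :
    NonconstantOn (phiSol n k₁ k₂) (halfLine n k₁ k₂) ∧
      NonconstantOn (fSol n k k₁ k₂) (halfLine n k₁ k₂) := by
  obtain ⟨a, ha⟩ := exists_denom_eq hn hk₁ k₂ 1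
  obtain ⟨b, hb⟩ := exists_denom_eq hn hk₁ k₂ 2
  have hn2 : 0 < (n : ℝ) - 2 := by
    have : (3 : ℝ) ≤ n := by exact_mod_cast hn
    linarith
  have ma : a ∈ halfLine n k₁ k₂ := mem_halfLine.2 (by rw [ha]; norm_num)
  have mb : b ∈ halfLine n k₁ k₂ := mem_halfLine.2 (by rw [hb]; norm_num)
  refine ⟨⟨a, ma, b, mb, ?_⟩, ⟨a, ma, b, mb, ?_⟩⟩
  · unfold phiSol
    rw [← denom, ← denom, ha, hb, div_self two_ne_zero, Real.one_rpow, div_one]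
    exact (Real.one_lt_rpow one_lt_two (div_pos two_pos hn2)).ne'
  · unfold fSol
    rw [← denom, ← denom, ha, hb]
    intro h
    linarith

/-- Solving the equations of Ricci-flatness. -/
lemma exists_sol_of_ricciFlatEqs (hn : 3 ≤ n) {I : Set ℝ} (hI : IsOpen I) (hIc : I.OrdConnected)
    {φ f : ℝ → ℝ} (hφ : ContDiffOn ℝ ∞ φ I) (hf : ContDiffOn ℝ ∞ f I)
    (hφ0 : ∀ t ∈ I, φ t ≠ 0) (hf0 : ∀ t ∈ I, 0 < f t)
    (hφn : NonconstantOn φ I) (hfn : NonconstantOn f I)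
    (h : ∀ t ∈ I, RicciFlatEqs n φ f t) :
    ∃ k k₁ k₂ : ℝ, 0 < k ∧ k₁ ≠ 0 ∧ I ⊆ halfLine n k₁ k₂ ∧
      ∀ t ∈ I, |φ t| = phiSol n k₁ k₂ t ∧ f t = fSol n k k₁ k₂ t := by
  -- The exponents `n-2` and `n-1` become the natural numbers `m+1` and `m+2`.
  obtain ⟨m, rfl⟩ : ∃ m, n = m + 3 := ⟨n - 3, by omega⟩
  have hm : (0 : ℝ) ≤ m := m.cast_nonneg
  have const : ∀ F : ℝ → ℝ, (∀ t ∈ I, HasDerivAt F 0 t) → ∃ c, ∀ t ∈ I, F t = c := fun F hF =>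
    hI.exists_is_const_of_deriv_eq_zero hIc.isPreconnected
      (fun t ht => (hF t ht).differentiableAt.differentiableWithinAt) fun t ht => (hF t ht).deriv
  have dφ := fun t ht => hasDerivAt_of_contDiffOn hI hφ (t := t) ht
  have df := fun t ht => hasDerivAt_of_contDiffOn hI hf (t := t) ht
  have nonconst : ∀ g : ℝ → ℝ, (∀ t ∈ I, HasDerivAt g (deriv g t) t) → NonconstantOn g I →
      ¬ ∀ t ∈ I, deriv g t = 0 := by
    rintro g hg ⟨s, hs, t, ht, hne⟩ h0
    obtain ⟨c, hc⟩ := const g fun r hr => h0 r hr ▸ hg r hr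
    exact hne ((hc s hs).trans (hc t ht).symm)
  -- The derivative is `f φ^(2-n)` times the base equation.
  obtain ⟨c, hc⟩ := const (fun t => deriv φ t * f t / φ t ^ (m + 2)) fun t ht => by
    have h0 := hφ0 t ht
    have h1 := (hf0 t ht).ne'
    refine (((dφ t ht).2.mul (df t ht).1).div ((dφ t ht).1.pow (m + 2))
      (pow_ne_zero _ h0)).congr_deriv ?_
    have hb := (h t ht).base
    push_cast at hb
    rw [div_eq_zero_iff]
    left
    simp only [Pi.mul_apply, Pi.pow_apply, Nat.add_succ_sub_one]
    push_cast
    field_simp at hb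
    linear_combination φ t ^ (m + 1) * hb
  have hφ' : ∀ t ∈ I, deriv φ t ≠ 0 := by
    have hc0 : c ≠ 0 := by
      rintro rfl
      refine nonconst φ (fun t ht => (dφ t ht).1) hφn fun t ht => ?_
      simpa [hφ0 t ht, (hf0 t ht).ne'] using hc t ht
    intro t ht h0
    apply hc0
    simpa [h0] using (hc t ht).symm
  have huv : ∀ t ∈ I, (m + 1) * (deriv φ t / φ t) = 2 * (deriv f t / f t) := by
    intro t ht
    have h1 := (hf0 t ht).ne'
    have hu : deriv φ t / φ t ≠ 0 := div_ne_zero (hφ' t ht) (hφ0 t ht)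
    obtain ⟨e1, e2, e3⟩ := h t ht
    have e3' : deriv (deriv f) t / f t
        = (m + 1) * (deriv φ t / φ t) * (deriv f t / f t) := by
      push_cast at e3
      field_simp
      field_simp at e3
      linear_combination e3
    rw [e3'] at e1
    push_cast at e1 e2
    have hm2 : (m : ℝ) + 2 ≠ 0 := by positivity
    -- Mixed minus `(n-2)` times base cancels `φ''`, leaving the common factor `(n-1) u`.
    apply mul_left_cancel₀ (mul_ne_zero hm2 hu)
    linear_combination e1 - (m + 1) * e2
  obtain ⟨c₁, hc₁⟩ := const (fun t => deriv f t / f t ^ 2) fun t ht => by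
    have h1 := (hf0 t ht).ne'
    refine ((df t ht).2.div ((df t ht).1.pow 2) (pow_ne_zero _ h1)).congr_deriv ?_
    have e3 := (h t ht).fiber
    push_cast at e3
    have e := huv t ht
    have e4 : deriv (deriv f) t = 2 * (deriv f t / f t) * deriv f t := by
      linear_combination e3 + deriv f t * e
    rw [div_eq_zero_iff, e4]
    left
    simp
    field_simp
    ring
  have hc₁0 : c₁ ≠ 0 := by
    rintro rfl
    refine nonconst f (fun t ht => (df t ht).1) hfn fun t ht => ?_
    simpa [(hf0 t ht).ne'] using hc₁ t ht
  obtain ⟨c₂, hc₂⟩ := const (fun t => (f t)⁻¹ + c₁ * t) fun t ht => by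
    have h1 := (hf0 t ht).ne'
    refine (((df t ht).1.inv h1).add ((hasDerivAt_id t).const_mul c₁)).congr_deriv ?_
    rw [← hc₁ t ht]
    ring
  obtain ⟨D, hD⟩ := const (fun t => f t ^ 2 / φ t ^ (m + 1)) fun t ht => by
    have h0 := hφ0 t ht
    have h1 := (hf0 t ht).ne'
    refine (((df t ht).1.pow 2).div ((dφ t ht).1.pow (m + 1)) (pow_ne_zero _ h0)).congr_deriv ?_
    rw [div_eq_zero_iff]
    left
    have e := huv t ht
    field_simp at e
    simp only [Pi.pow_apply]
    push_cast
    simp only [pow_one]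
    linear_combination -f t * φ t ^ m * e
  have hne : ∃ t, t ∈ I := by
    obtain ⟨s, hs, -⟩ := hφn
    exact ⟨s, hs⟩
  have hD0 : 0 < |D| := by
    obtain ⟨t, ht⟩ := hne
    rw [← hD t ht]
    exact abs_pos.2 (div_ne_zero (pow_ne_zero _ (hf0 t ht).ne') (pow_ne_zero _ (hφ0 t ht)))
  -- `D` is negative when `φ < 0` and `n` is odd, hence the absolute value; then `|φ|^(n-2) =
  -- (f/k)²`.
  set k := √|D| with hk
  have hk0 : 0 < k := Real.sqrt_pos.2 hD0
  have hk2 : k ^ 2 = |D| := Real.sq_sqrt hD0.le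
  have hm1 : (m : ℝ) + 1 ≠ 0 := by positivity
  -- `k₁` and `k₂` are read off from `1/f = c₂ - c₁ t` multiplied by `2k`.
  have hL : ∀ t ∈ I, denom (m + 3) (2 * k * c₁ / (m + 1)) (2 * k * c₂) t = 2 * k / f t := by
    intro t ht
    rw [denom, ← hc₂ t ht]
    push_cast
    field_simp
    ring
  refine ⟨k, 2 * k * c₁ / (m + 1), 2 * k * c₂, hk0, by positivity, fun t ht => ?_, fun t ht => ?_⟩
  · rw [mem_halfLine, hL t ht]
    exact div_pos (mul_pos two_pos hk0) (hf0 t ht)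
  · have h1 := hf0 t ht
    constructor
    · have hpow : |φ t| ^ (m + 1) = (f t / k) ^ 2 := by
        rw [div_pow, hk2, ← hD t ht, abs_div, abs_pow, abs_pow, abs_of_pos h1]
        have := abs_pos.2 (hφ0 t ht)
        field_simp
      have e : (2 : ℝ) / (2 * k / f t) = f t / k := by field_simp
      rw [phiSol, ← denom, hL t ht, e,
        ← Real.pow_rpow_inv_natCast (abs_nonneg (φ t)) (Nat.succ_ne_zero m), Nat.succ_eq_add_one,
        hpow, ← Real.rpow_natCast, ← Real.rpow_mul (div_pos h1 hk0).le]
      congr 1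
      push_cast
      ring
    · rw [fSol, ← denom, hL t ht]
      field_simp

end Solutions

end WarpedRicci

theorem theorem1p3 (n : ℕ) (hn : 3 ≤ n)
    (ε : Fin n → ℝ) (hε : ∀ i, ε i = 1 ∨ ε i = -1)
    (α : Fin n → ℝ) (hα : ∑ i, ε i * α i ^ 2 ≠ 0) :
    (∀ (I : Set ℝ) (φ f : ℝ → ℝ), IsOpen I → I.OrdConnected →
      ContDiffOn ℝ ∞ φ I → ContDiffOn ℝ ∞ f I →
      (∀ t ∈ I, φ t ≠ 0) → (∀ t ∈ I, 0 < f t) →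
      WarpedRicci.NonconstantOn φ I → WarpedRicci.NonconstantOn f I →
      (WarpedRicci.WarpedProductIsRicciFlat ε α I φ f ↔
        ∃ k k₁ k₂ : ℝ, 0 < k ∧ k₁ ≠ 0 ∧ I ⊆ WarpedRicci.halfLine n k₁ k₂ ∧
          ∀ t ∈ I, |φ t| = WarpedRicci.phiSol n k₁ k₂ t ∧
            f t = WarpedRicci.fSol n k k₁ k₂ t)) ∧
    (∀ k k₁ k₂ : ℝ, 0 < k → k₁ ≠ 0 →
      ContDiffOn ℝ ∞ (WarpedRicci.phiSol n k₁ k₂) (WarpedRicci.halfLine n k₁ k₂) ∧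
      ContDiffOn ℝ ∞ (WarpedRicci.fSol n k k₁ k₂) (WarpedRicci.halfLine n k₁ k₂) ∧
      (∀ t ∈ WarpedRicci.halfLine n k₁ k₂,
        0 < WarpedRicci.phiSol n k₁ k₂ t ∧ 0 < WarpedRicci.fSol n k k₁ k₂ t) ∧
      WarpedRicci.NonconstantOn (WarpedRicci.phiSol n k₁ k₂) (WarpedRicci.halfLine n k₁ k₂) ∧
      WarpedRicci.NonconstantOn (WarpedRicci.fSol n k k₁ k₂) (WarpedRicci.halfLine n k₁ k₂) ∧
      WarpedRicci.WarpedProductIsRicciFlat ε α (WarpedRicci.halfLine n k₁ k₂)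
        (WarpedRicci.phiSol n k₁ k₂) (WarpedRicci.fSol n k k₁ k₂)) := by
  have hn2 : 2 ≤ n := by omega
  constructor
  · intro I φ f hI hIc hφ hf hφ0 hf0 hφn hfn
    rw [WarpedRicci.warpedProductIsRicciFlat_iff hn2 hε hα hI hφ hf hφ0 fun t ht => (hf0 t ht).ne']
    refine ⟨WarpedRicci.exists_sol_of_ricciFlatEqs hn hI hIc hφ hf hφ0 hf0 hφn hfn, ?_⟩
    rintro ⟨k, k₁, k₂, hk, -, hsub, hsol⟩ t ht
    have hnear : ∀ᶠ s in 𝓝 t, s ∈ I := hI.mem_nhds ht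
    have hcont : ContinuousAt φ t := (hφ.continuousOn).continuousAt (hI.mem_nhds ht)
    have hfe : f =ᶠ[𝓝 t] WarpedRicci.fSol n k k₁ k₂ := hnear.mono fun s hs => (hsol s hs).2
    have heqs := WarpedRicci.ricciFlatEqs_sol hn hk (hsub ht)
    -- By continuity `φ` keeps its sign near `t`, so there `φ = ± phiSol`.
    rcases (hφ0 t ht).lt_or_gt with hneg | hpos
    · refine heqs.congr (c := -1) (by norm_num) ?_ hfe
      filter_upwards [hnear, hcont.eventually (gt_mem_nhds hneg)] with s hs hs'
      rw [← (hsol s hs).1, abs_of_neg hs']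
      ring
    · refine heqs.congr (c := 1) one_ne_zero ?_ hfe
      filter_upwards [hnear, hcont.eventually (lt_mem_nhds hpos)] with s hs hs'
      rw [← (hsol s hs).1, abs_of_pos hs', one_mul]
  · intro k k₁ k₂ hk hk₁
    obtain ⟨hP, hF⟩ := WarpedRicci.nonconstantOn_sol hn (k₂ := k₂) hk hk₁
    refine ⟨WarpedRicci.contDiffOn_phiSol k₁ k₂, WarpedRicci.contDiffOn_fSol k k₁ k₂,
      fun t ht => ⟨WarpedRicci.phiSol_pos ht, WarpedRicci.fSol_pos hk ht⟩, hP, hF, ?_⟩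
    exact (WarpedRicci.warpedProductIsRicciFlat_iff hn2 hε hα (WarpedRicci.isOpen_halfLine k₁ k₂)
      (WarpedRicci.contDiffOn_phiSol k₁ k₂) (WarpedRicci.contDiffOn_fSol k k₁ k₂)
      (fun t ht => (WarpedRicci.phiSol_pos ht).ne')
      fun t ht => (WarpedRicci.fSol_pos hk ht).ne').2
        fun t ht => WarpedRicci.ricciFlatEqs_sol hn hk ht
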